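/- Conventions. Let $m,b\ge 1$, $n=mb$, $z=\frac{2^{mb}-1}{2^m-1}$. Vectors are row vectors unless multiplied by a matrix from the left, and $e^n=(0,\dots,0,1)\in\mathbb F_2^n$. A polynomial over $\mathbb F_2$ of degree $k$ is primitive if it is monic, irreducible and its roots have multiplicative order $2^k-1$. The companion matrix $M_f\in\mathbb F_2^{k\times k}$ of $f=x^k+c_{k-1}x^{k-1}+\dots+c_0$ has ones on the subdiagonal, last column $(c_0,\dots,c_{k-1})^T$ and zeros elsewhere. A $\sigma$-LFSR with $b$ delay blocks, each with $m$ inputs and $m$ outputs, is given by gain matrices $B_0,\dots,B_{b-1}\in\mathbb F_2^{m\times m}$. Its output sequences are the sequences $S(t)\in\mathbb F_2^m$ (columns), $t\ge0$, with $S(t+b)=\sum_{i=0}^{b-1}B_iS(t+i)$; its configuration matrix is the $m$-companion matrix $$C=\begin{bmatrix}0&I&&\\&&\ddots&\\&&&I\\B_0&B_1&\cdots&B_{b-1}\end{bmatrix}\in\mathbb F_2^{mb\times mb},$$ whose characteristic polynomial is called the characteristic polynomial of the $\sigma$-LFSR. The $\sigma$-LFSR is primitive if this polynomial is primitive. Its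 distance vector is $(d_1,\dots,d_{m-1})$, where, for every nonzero output sequence, $d_i\ge0$ is the least number of left shifts that takes the first component sequence to the $(i+1)$-st. A primitive $\sigma$-LFSR is $z$-primitive if $z$ divides all $d_i$. For a primitive $f$ of degree $mb$, $z_{mb}^f$ is the set of distance vectors of $z$-primitive $\sigma$-LFSRs with $b$ delay blocks and characteristic polynomial $f$; $z_m^g$ is this set for one delay block and a primitive polynomial $g$ of degree $m$. Sampling algorithm for $z_m^g$. Start with $i=2$, an empty list, and $m\times m$ matrices $M_1,M_2$ both with first row $e^m$ and other rows $0$. While $i\le m$: draw an arbitrary integer $d\in\{1,\dots,2^m-1\}$, and put $e^mM_g^d$ in row $i$ of $M_1$ and of $M_2$; for $j=1,\dots,i-1$ in turn add $M_2[i,m-j+1]\cdot M_2[j,:]$ to row $i$ of $M_2$; if then $M_2[i,m-i+1]=1$, append $d$ to the list and increase $i$ by $1$. When $i=m+1$, output the list. Theorem. Let $f\in\mathbb F_2[x]$ be a primitive polynomial of degree $mb$, let $\alpha$ be a root of $f$ in an extension field of $\mathbb F_2$, and let $g\in\mathbb F_2[x]$ be the polynomial of degree $m$ with $g(\alpha^z)=0$.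 Every list output by the sampling algorithm for $g$, whatever the random draws, is an element of $z_m^g$. Moreover, for every $D=(d_1,\dots,d_{m-1})\in z_m^g$ (in particular for every output of the sampling algorithm), put $w_i=e^nM_f^{zd_i}$ for $1\le i\le m-1$ and let $Q\in\mathbb F_2^{n\times n}$ be the matrix with rows $$e^n,w_1,\dots,w_{m-1},\;e^nM_f,w_1M_f,\dots,w_{m-1}M_f,\;\dots,\;e^nM_f^{b-1},w_1M_f^{b-1},\dots,w_{m-1}M_f^{b-1}.$$ Then $Q$ is invertible, and $QM_fQ^{-1}$ is the configuration matrix of a $\sigma$-LFSR with $b$ delay blocks, each with $m$ inputs and $m$ outputs, whose characteristic polynomial is $f$ and whose distance vector is $(zd_1,\dots,zd_{m-1})$. In particular this $\sigma$-LFSR is $z$-primitive. -/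

import Mathlib

open Polynomial Matrix

namespace SigmaLFSR

/-- A primitive polynomial over `𝔽₂`: monic, irreducible, and its root has multiplicative order
`2 ^ deg f - 1`, i.e. it generates the multiplicative group of `𝔽₂[x]/(f)`. -/
def IsPrimitivePoly (f : (ZMod 2)[X]) : Prop :=
  f.Monic ∧ Irreducible f ∧ orderOf (AdjoinRoot.root f) = 2 ^ f.natDegree - 1

/-- The companion matrix of `f = x ^ n + c_{n-1} x ^ (n-1) + ⋯ + c_0`: ones on the subdiagonal and
last column `(c_0, …, c_{n-1})`. -/
def companionMatrix (n : ℕ) (f : (ZMod 2)[X]) : Matrix (Fin n) (Fin n) (ZMod 2) :=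
  Matrix.of fun i j =>
    if j.val + 1 = n then f.coeff i.val else if i.val = j.val + 1 then 1 else 0

/-- The row vector `(0, …, 0, 1)` of length `n`. -/
def lastUnit (n : ℕ) : Fin n → ZMod 2 :=
  fun i => if i.val + 1 = n then 1 else 0

/-- `z = (2 ^ (m b) - 1) / (2 ^ m - 1)`; for `0 < m` the division is exact. -/
def zIndex (m b : ℕ) : ℕ := (2 ^ (m * b) - 1) / (2 ^ m - 1)

/-- The configuration matrix (an `m`-companion matrix) of the σ-LFSR with `b` delay blocks and
feedback gain matrices `B_0, …, B_{b-1}`: identity blocks above the block diagonal and last block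
row `B_0, …, B_{b-1}`. Rows and columns are indexed by (block, position inside the block). -/
def configMatrix {m b : ℕ} (B : Fin b → Matrix (Fin m) (Fin m) (ZMod 2)) :
    Matrix (Fin b × Fin m) (Fin b × Fin m) (ZMod 2) :=
  Matrix.of fun r c =>
    if r.1.val + 1 = b then B c.1 r.2 c.2
    else if c.1.val = r.1.val + 1 ∧ c.2 = r.2 then 1 else 0

/-- The configuration matrix with rows and columns numbered `0, …, b * m - 1`, block after block. -/
def configMatrixFin {m b : ℕ} (B : Fin b → Matrix (Fin m) (Fin m) (ZMod 2)) :
    Matrix (Fin (b * m)) (Fin (b * m)) (ZMod 2) :=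
  Matrix.reindex finProdFinEquiv finProdFinEquiv (configMatrix B)

/-- `S` is an output sequence of the σ-LFSR with gain matrices `B`. -/
def IsOutput {m b : ℕ} (B : Fin b → Matrix (Fin m) (Fin m) (ZMod 2))
    (S : ℕ → Fin m → ZMod 2) : Prop :=
  ∀ t : ℕ, S (t + b) = ∑ i : Fin b, B i *ᵥ S (t + i.val)

/-- `(D 0, …, D (m-2))` is the distance vector of the σ-LFSR: for each nonzero output sequence,
`D i` is the number of left shifts needed (hence the least such number) to get from the first
component sequence to component sequence number `i + 2`. -/
def IsDistanceVector {m b : ℕ} (B : Fin b → Matrix (Fin m) (Fin m) (ZMod 2))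
    (D : Fin (m - 1) → ℕ) : Prop :=
  ∀ S : ℕ → Fin m → ZMod 2, IsOutput B S → S ≠ 0 → ∀ i : Fin (m - 1),
    IsLeast {d : ℕ | ∀ t : ℕ, S t ⟨i.val + 1, by omega⟩ =
      S (t + d) ⟨0, by have := i.isLt; omega⟩} (D i)

/-- A σ-LFSR is primitive if its characteristic polynomial, that is, the characteristic polynomial
of its configuration matrix, is primitive. -/
def IsPrimitiveLFSR {m b : ℕ} (B : Fin b → Matrix (Fin m) (Fin m) (ZMod 2)) : Prop :=
  IsPrimitivePoly (configMatrix B).charpoly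

/-- A primitive σ-LFSR is `z`-primitive if all entries of its distance vector are divisible
by `z`. -/
def IsZPrimitive {m b : ℕ} (B : Fin b → Matrix (Fin m) (Fin m) (ZMod 2)) : Prop :=
  IsPrimitiveLFSR B ∧
    ∃ D : Fin (m - 1) → ℕ, IsDistanceVector B D ∧ ∀ i, zIndex m b ∣ D i

/-- The `z`-set of `f`: the distance vectors of the `z`-primitive σ-LFSRs with `b` delay blocks,
each with `m` inputs and `m` outputs, and characteristic polynomial `f`. -/
def zSet (m b : ℕ) (f : (ZMod 2)[X]) : Set (Fin (m - 1) → ℕ) :=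
  {D | ∃ B : Fin b → Matrix (Fin m) (Fin m) (ZMod 2),
    (configMatrix B).charpoly = f ∧ IsZPrimitive B ∧ IsDistanceVector B D}

/-! The randomized algorithm that samples an element of the `z`-set of `g` for one delay block.
Row and column indices are 0-based. -/

/-- The variables of the algorithm: `i` is the index of the row that is to be filled next. -/
structure GenState (m : ℕ) where
  i : ℕ
  M₁ : Matrix (Fin m) (Fin m) (ZMod 2)
  M₂ : Matrix (Fin m) (Fin m) (ZMod 2)
  list : List ℕ

/-- At the start the first row of both matrices is `(0, …, 0, 1)` and the other rows vanish. -/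
def genInit (m : ℕ) : GenState m where
  i := 1
  M₁ := Matrix.of fun r => if r.val = 0 then lastUnit m else 0
  M₂ := Matrix.of fun r => if r.val = 0 then lastUnit m else 0
  list := []

/-- The inner loop: for `j = 0, …, k - 1` in turn, add to the vector its entry in column
`m - 1 - j` times row `j` of `M₂`. -/
def reduceRow {m : ℕ} (M₂ : Matrix (Fin m) (Fin m) (ZMod 2)) (v : Fin m → ZMod 2) :
    ℕ → (Fin m → ZMod 2)
  | 0 => v
  | j + 1 =>
    if h : j < m then
      reduceRow M₂ v j + reduceRow M₂ v j (Fin.rev ⟨j, h⟩) • M₂ ⟨j, h⟩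
    else reduceRow M₂ v j

/-- One pass through the outer loop with the drawn integer `d`: the new rows are written, and `d`
is accepted if the reduced row has a `1` on the antidiagonal. -/
def genStep {m : ℕ} (Mg : Matrix (Fin m) (Fin m) (ZMod 2)) (s : GenState m) (h : s.i < m)
    (d : ℕ) : GenState m :=
  let v : Fin m → ZMod 2 := lastUnit m ᵥ* Mg ^ d
  let u : Fin m → ZMod 2 := reduceRow s.M₂ v s.i
  { i := if u (Fin.rev ⟨s.i, h⟩) = 1 then s.i + 1 else s.i
    M₁ := s.M₁.updateRow ⟨s.i, h⟩ v
    M₂ := s.M₂.updateRow ⟨s.i, h⟩ u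
    list := if u (Fin.rev ⟨s.i, h⟩) = 1 then s.list ++ [d] else s.list }

/-- The states that the algorithm can reach, for some outcome of the random draws from
`{1, …, 2 ^ m - 1}`. -/
inductive GenReachable {m : ℕ} (Mg : Matrix (Fin m) (Fin m) (ZMod 2)) : GenState m → Prop
  | init : GenReachable Mg (genInit m)
  | step (s : GenState m) (d : ℕ) (hs : GenReachable Mg s) (h : s.i < m)
      (hd : 1 ≤ d ∧ d ≤ 2 ^ m - 1) : GenReachable Mg (genStep Mg s h d)

/-- `D` is a possible output list of the algorithm for the input `M_g`: all `m` rows have been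
filled, and the list of accepted integers is `D`. -/
def IsGenOutput (m : ℕ) (g : (ZMod 2)[X]) (D : Fin (m - 1) → ℕ) : Prop :=
  ∃ s : GenState m, GenReachable (companionMatrix m g) s ∧ s.i = m ∧ s.list = List.ofFn D

/-! The algorithm that turns a distance vector for `g` into a configuration matrix. -/

/-- The rows `e, w_1, …, w_{m-1}` with `e = (0, …, 0, 1)` and `w_k = e * M_f ^ (z * d_k)`. -/
def genRow (m b : ℕ) (f : (ZMod 2)[X]) (D : Fin (m - 1) → ℕ) (k : Fin m) :
    Fin (b * m) → ZMod 2 :=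
  if h : k.val = 0 then lastUnit (b * m)
  else lastUnit (b * m) ᵥ*
    companionMatrix (b * m) f ^ (zIndex m b * D ⟨k.val - 1, by omega⟩)

/-- The matrix `Q`, with rows `e, w_1, …, w_{m-1}, e M_f, w_1 M_f, …, w_{m-1} M_f ^ (b - 1)`. -/
def genQ (m b : ℕ) (f : (ZMod 2)[X]) (D : Fin (m - 1) → ℕ) :
    Matrix (Fin (b * m)) (Fin (b * m)) (ZMod 2) :=
  Matrix.of fun r =>
    genRow m b f D (finProdFinEquiv.symm r).2 ᵥ*
      companionMatrix (b * m) f ^ (finProdFinEquiv.symm r).1.val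

/-- The output `Q * M_f * Q⁻¹` of the algorithm. -/
noncomputable def configGen (m b : ℕ) (f : (ZMod 2)[X]) (D : Fin (m - 1) → ℕ) :
    Matrix (Fin (b * m)) (Fin (b * m)) (ZMod 2) :=
  genQ m b f D * companionMatrix (b * m) f * (genQ m b f D)⁻¹

end SigmaLFSR

open SigmaLFSR

namespace SigmaLFSR

/-! Put β = α^z and d_0 = 0. Everything passes through one condition on D: each d_i is below 2^m -
1, and the powers β^{d_k} are linearly independent over 𝔽₂ (`IndepExponents`). Elements of the z-set
of g satisfy it (`bound_and_indepExponents_of_mem_zSet`), and so do outputs of the sampling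
algorithm (`bound_and_indepExponents_of_isGenOutput`).

Conversely the condition suffices (`config_of_indepExponents`). The field 𝔽₂(β) has degree m, and α
has degree b over it, so the products β^{d_k} α^i form an 𝔽₂-basis of 𝔽₂(α)
(`IndepExponents.tower`). Since 𝔽₂[M_f] is a field, this independence passes to the rows e M_f^{z
d_k + i} of Q. Multiplying by M_f moves each block of rows to the next one, so Q M_f Q⁻¹ is an
m-companion matrix. Its output sequences are S_k(t) = e M_f^{t + z d_k} y, which shows the
distances. The claim on sampling is the case b = 1, f = g. -/

theorem monic_of_ne_zero {g : (ZMod 2)[X]} (hg : g ≠ 0) : g.Monic := by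
  have h : ∀ a : ZMod 2, a ≠ 0 → a = 1 := by decide
  exact h _ (leadingCoeff_ne_zero.mpr hg)

theorem companionMatrix_charpoly {n : ℕ} {f : (ZMod 2)[X]} (hf : f.Monic)
    (hn : f.natDegree = n) : (companionMatrix n f).charpoly = f := by
  subst hn
  -- The companion matrix represents multiplication by the root in the power basis; the usual signs
  -- in the last column vanish in characteristic 2.
  have hmin : minpoly (ZMod 2) (AdjoinRoot.root f) = f := by
    rw [AdjoinRoot.minpoly_root hf.ne_zero, hf.leadingCoeff]; simp
  have h1 := charpoly_leftMulMatrix (AdjoinRoot.powerBasis' hf)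
  rw [PowerBasis.leftMulMatrix, PowerBasis.minpolyGen_eq, AdjoinRoot.powerBasis'_gen, hmin] at h1
  simp only [ZMod.neg_eq_self_mod_two] at h1
  exact h1

/-! ### Polynomials in a matrix annihilated by an irreducible polynomial -/

section Aeval

variable {ι κ : Type*} [Fintype ι] [DecidableEq ι]

theorem isUnit_aeval_of_not_dvd {A : Matrix ι ι (ZMod 2)} {f p : (ZMod 2)[X]}
    (hf : Irreducible f) (hA : aeval A f = 0) (hp : ¬ f ∣ p) : IsUnit (aeval A p) := by
  obtain ⟨u, v, huv⟩ := (hf.coprime_iff_not_dvd).mpr hp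
  have h : aeval A (u * f + v * p) = 1 := by rw [huv, map_one]
  rw [map_add, map_mul, map_mul, hA, mul_zero, zero_add] at h
  exact IsUnit.of_mul_eq_one_right _ h

/-- Powers of a root of `g` with exponents `e k` are linearly independent over `𝔽₂`. -/
def IndepExponents (g : (ZMod 2)[X]) (e : κ → ℕ) [Fintype κ] : Prop :=
  ∀ c : κ → ZMod 2, g ∣ ∑ k, C (c k) * X ^ e k → c = 0

variable [Fintype κ]

theorem aeval_sum_C_mul_X_pow {R : Type*} [Ring R] [Algebra (ZMod 2) R] (a : R)
    (c : κ → ZMod 2) (e : κ → ℕ) :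
    aeval a (∑ k, C (c k) * X ^ e k) = ∑ k, c k • a ^ e k := by
  simp [map_sum, Algebra.smul_def]

/-- A relation among the vectors reads v p(A) = 0. If f does not divide p, then p(A) is invertible,
so any nonzero v will do. -/
theorem IndepExponents.linearIndependent_vecMul {A : Matrix ι ι (ZMod 2)} {f : (ZMod 2)[X]}
    (hf : Irreducible f) (hA : aeval A f = 0) {v : ι → ZMod 2} (hv : v ≠ 0) {e : κ → ℕ}
    (he : IndepExponents f e) : LinearIndependent (ZMod 2) fun k => v ᵥ* A ^ e k := by
  rw [Fintype.linearIndependent_iff]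
  intro c hc
  have h : v ᵥ* aeval A (∑ k, C (c k) * X ^ e k) = 0 := by
    rw [aeval_sum_C_mul_X_pow, ← hc]
    simp only [Matrix.vecMul_sum, Matrix.vecMul_smul]
  refine congrFun (he c ?_)
  by_contra hd
  exact hv ((Matrix.vecMul_injective_iff_isUnit.mpr (isUnit_aeval_of_not_dvd hf hA hd))
    (h.trans (Matrix.zero_vecMul _).symm))

theorem indepExponents_of_linearIndependent_vecMul {A : Matrix ι ι (ZMod 2)} {f : (ZMod 2)[X]}
    (hA : aeval A f = 0) {v : ι → ZMod 2} {e : κ → ℕ}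
    (h : LinearIndependent (ZMod 2) fun k => v ᵥ* A ^ e k) : IndepExponents f e := by
  rintro c ⟨q, hq⟩
  rw [Fintype.linearIndependent_iff] at h
  refine funext (h c ?_)
  have h1 := congrArg (fun p => v ᵥ* aeval A p) hq
  simp only [map_mul, hA, zero_mul, Matrix.vecMul_zero] at h1
  rw [← h1, aeval_sum_C_mul_X_pow]
  simp only [Matrix.vecMul_sum, Matrix.vecMul_smul]

end Aeval

/-! ### Arithmetic of z and the order of α^z -/

theorem zIndex_mul {m : ℕ} (b : ℕ) : zIndex m b * (2 ^ m - 1) = 2 ^ (m * b) - 1 := by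
  refine Nat.div_mul_cancel ?_
  have := Nat.sub_dvd_pow_sub_pow (2 ^ m) 1 b
  rwa [one_pow, ← pow_mul] at this

theorem zIndex_one {m : ℕ} (hm : 0 < m) : zIndex m 1 = 1 := by
  have : 1 < 2 ^ m := Nat.one_lt_two_pow hm.ne'
  rw [zIndex, mul_one, Nat.div_self (by omega)]

theorem two_pow_sub_one_pos {m : ℕ} (hm : 0 < m) : 0 < 2 ^ m - 1 := by
  have : 1 < 2 ^ m := Nat.one_lt_two_pow hm.ne'
  omega

theorem zIndex_pos {m b : ℕ} (hm : 0 < m) (hb : 0 < b) : 0 < zIndex m b :=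
  Nat.pos_of_mul_pos_right ((zIndex_mul (m := m) b).symm ▸ two_pow_sub_one_pos (Nat.mul_pos hm hb))

theorem orderOf_pow_zIndex {L : Type*} [Field L] {m b : ℕ} (hm : 0 < m)
    (hb : 0 < b) {α : L} (hα : orderOf α = 2 ^ (m * b) - 1) : orderOf (α ^ zIndex m b) = 2 ^ m - 1 := by
  have h := zIndex_mul (m := m) b
  rw [orderOf_pow_of_dvd (zIndex_pos hm hb).ne' (by rw [hα, ← h]; exact dvd_mul_right _ _), hα, ← h,
    Nat.mul_div_cancel_left _ (zIndex_pos hm hb)]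

/-! ### Finite field extensions -/

section Field

variable {L : Type*} [Field L] [Algebra (ZMod 2) L]

/-- With d the degree of β, the field 𝔽₂(β) has 2^d elements, so the order 2^m - 1 of β divides 2^d
- 1. -/
theorem le_natDegree_minpoly_of_orderOf {m : ℕ} (hm : 0 < m) {β : L}
    (hint : IsIntegral (ZMod 2) β)
    (hβ : orderOf β = 2 ^ m - 1) : m ≤ (minpoly (ZMod 2) β).natDegree := by
  set E := IntermediateField.adjoin (ZMod 2) {β}
  have hpos := two_pow_sub_one_pos hm
  have : FiniteDimensional (ZMod 2) E := IntermediateField.adjoin.finiteDimensional hint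
  have : Finite E := Module.finite_of_finite (ZMod 2)
  have : Fintype E := Fintype.ofFinite E
  have hcard : Fintype.card E = 2 ^ (minpoly (ZMod 2) β).natDegree := by
    rw [← IntermediateField.adjoin.finrank hint, Module.card_eq_pow_finrank (K := ZMod 2),
      ZMod.card]
  have hβ0 : β ≠ 0 := by
    rintro rfl
    rw [orderOf_zero] at hβ
    omega
  have hgen : IntermediateField.AdjoinSimple.gen (ZMod 2) β ≠ 0 := fun h => hβ0 (by
    simpa using congrArg (algebraMap E L) h)
  have h1 := congrArg (algebraMap E L) (FiniteField.pow_card_sub_one_eq_one _ hgen)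
  rw [map_pow, map_one, IntermediateField.AdjoinSimple.algebraMap_gen, hcard] at h1
  have hd := minpoly.natDegree_pos hint
  have hle := Nat.le_of_dvd (two_pow_sub_one_pos hd) (orderOf_dvd_of_pow_eq_one h1)
  rw [hβ] at hle
  have h2 : 2 ^ m ≤ 2 ^ (minpoly (ZMod 2) β).natDegree := by omega
  exact (Nat.pow_le_pow_iff_right (by norm_num)).mp h2

theorem minpoly_eq_of_orderOf {m : ℕ} (hm : 0 < m) {β : L} (hβ : orderOf β = 2 ^ m - 1)
    {g : (ZMod 2)[X]} (hg : g.natDegree = m) (hgβ : aeval β g = 0) :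
    minpoly (ZMod 2) β = g := by
  have hg0 : g ≠ 0 := by rintro rfl; simp at hg; omega
  have hgm := monic_of_ne_zero hg0
  have hint : IsIntegral (ZMod 2) β := ⟨g, hgm, hgβ⟩
  exact (eq_of_monic_of_dvd_of_natDegree_le (minpoly.monic hint) hgm (minpoly.dvd _ _ hgβ)
    (hg ▸ le_natDegree_minpoly_of_orderOf hm hint hβ)).symm

theorem orderOf_root_eq {f : (ZMod 2)[X]} (hf : Irreducible f) {α : L} (hα : aeval α f = 0) :
    orderOf (AdjoinRoot.root f) = orderOf α := by
  have : Fact (Irreducible f) := ⟨hf⟩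
  have h := orderOf_injective
    (AdjoinRoot.liftAlgHom f (Algebra.ofId (ZMod 2) L) α hα : AdjoinRoot f →* L)
    (RingHom.injective (AdjoinRoot.liftAlgHom f (Algebra.ofId (ZMod 2) L) α hα).toRingHom)
    (AdjoinRoot.root f)
  rw [← h]
  exact congrArg orderOf (AdjoinRoot.lift_root hα)

theorem isPrimitivePoly_of_orderOf {m : ℕ} (hm : 0 < m) {β : L} (hβ : orderOf β = 2 ^ m - 1)
    {g : (ZMod 2)[X]} (hg : g.natDegree = m) (hgβ : aeval β g = 0) : IsPrimitivePoly g := by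
  have hg0 : g ≠ 0 := by rintro rfl; simp at hg; omega
  have hgm := monic_of_ne_zero hg0
  have hint : IsIntegral (ZMod 2) β := ⟨g, hgm, hgβ⟩
  have hirr : Irreducible g := minpoly_eq_of_orderOf hm hβ hg hgβ ▸ minpoly.irreducible hint
  exact ⟨hgm, hirr, by rw [orderOf_root_eq hirr hgβ, hβ, hg]⟩

/-- In the tower 𝔽₂ ⊆ E = 𝔽₂(α^z) ⊆ T = 𝔽₂(α) the degrees are m and b. Products of a family
independent over 𝔽₂ in E with the E-independent powers 1, …, α^{b-1} are independent over 𝔽₂.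
Working in T instead of L makes all degrees finite. -/
theorem IndepExponents.tower {m b : ℕ} (hm : 0 < m) {f g : (ZMod 2)[X]}
    (hfm : f.Monic) (hf : Irreducible f) (hfdeg : f.natDegree = m * b) {α : L}
    (hα : aeval α f = 0) (hgdeg : g.natDegree = m)
    {z : ℕ} (hmin : minpoly (ZMod 2) (α ^ z) = g) {e : Fin m → ℕ} (he : IndepExponents g e) :
    IndepExponents f fun r : Fin b × Fin m => z * e r.2 + r.1 := by
  have hintα : IsIntegral (ZMod 2) α := ⟨f, hfm, hα⟩
  set T := IntermediateField.adjoin (ZMod 2) {α} with hT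
  set a : T := IntermediateField.AdjoinSimple.gen (ZMod 2) α with ha
  have haα : algebraMap T L a = α := IntermediateField.AdjoinSimple.algebraMap_gen _ _
  have : FiniteDimensional (ZMod 2) T := IntermediateField.adjoin.finiteDimensional hintα
  have hTrank : Module.finrank (ZMod 2) T = m * b := by
    rw [IntermediateField.adjoin.finrank hintα, ← minpoly.eq_of_irreducible_of_monic hf hα hfm,
      hfdeg]
  have hinta : IsIntegral (ZMod 2) (a ^ z) := IsIntegral.of_finite _ _
  have hmina : minpoly (ZMod 2) (a ^ z) = g := by
    rw [← hmin, ← haα, ← map_pow, minpoly.algebraMap_eq (algebraMap T L).injective]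
  set E := IntermediateField.adjoin (ZMod 2) {a ^ z} with hE
  have hErank : Module.finrank (ZMod 2) E = m := by
    rw [IntermediateField.adjoin.finrank hinta, hmina, hgdeg]
  have hTE : Module.finrank E T = b := by
    have h := Module.finrank_mul_finrank (ZMod 2) E T
    rw [hErank, hTrank] at h
    exact Nat.eq_of_mul_eq_mul_left hm h
  have hgen : IntermediateField.adjoin E {a} = ⊤ := by
    have h1 : IntermediateField.adjoin (ZMod 2) {a} = ⊤ := by
      rw [Field.primitive_element_iff_minpoly_natDegree_eq, hTrank,
        ← minpoly.algebraMap_eq (algebraMap T L).injective a, haα,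
        ← minpoly.eq_of_irreducible_of_monic hf hα hfm, hfdeg]
    rw [← IntermediateField.restrictScalars_eq_top_iff (K := ZMod 2), eq_top_iff, ← h1,
      IntermediateField.adjoin_simple_le_iff]
    exact IntermediateField.mem_adjoin_simple_self E a
  have hdeg : (minpoly E a).natDegree = b := by
    rw [← hTE, ← Field.primitive_element_iff_minpoly_natDegree_eq]
    exact hgen
  set y : E := IntermediateField.AdjoinSimple.gen (ZMod 2) (a ^ z) with hy
  have hya : algebraMap E T y = a ^ z := IntermediateField.AdjoinSimple.algebraMap_gen _ _
  have hli1 : LinearIndependent (ZMod 2) fun k => y ^ e k := by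
    rw [Fintype.linearIndependent_iff]
    intro c hc
    refine congrFun (he c ?_)
    rw [← hmina]
    refine minpoly.dvd _ _ ?_
    rw [← hya, aeval_algebraMap_apply, aeval_sum_C_mul_X_pow, hc, map_zero]
  have hli2 : LinearIndependent E fun i : Fin b => a ^ (i : ℕ) := by
    have := linearIndependent_pow (K := E) a
    rw [hdeg] at this
    exact this
  have hli := (linearIndependent_smul hli1 hli2)
  rw [Fintype.linearIndependent_iff] at hli
  intro c hc
  have hc0 : ∑ k : Fin b × Fin m, c k • a ^ (z * e k.2 + k.1) = 0 := by
    obtain ⟨q, hq⟩ := hc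
    have haf : aeval a f = 0 := by
      apply (algebraMap T L).injective
      rw [← aeval_algebraMap_apply, haα, hα, map_zero]
    rw [← aeval_sum_C_mul_X_pow, hq, map_mul, haf, zero_mul]
  -- The product family is indexed by (exponent, power of a), the rows of Q by (block, position).
  have h := hli (fun k => c k.swap) (by
    rw [← hc0, ← (Equiv.prodComm (Fin m) (Fin b)).sum_comp]
    refine Finset.sum_congr rfl fun k _ => ?_
    rw [pow_add, pow_mul, ← hya, Algebra.smul_def (y ^ e k.1), map_pow]
    rfl)
  funext k
  exact h k.swap

end Field

/-! ### Rows of Q as powers of the companion matrix -/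

/-- The exponents `0, D 0, …, D (m - 2)`. -/
def extendZero {m : ℕ} (D : Fin (m - 1) → ℕ) (k : Fin m) : ℕ :=
  if h : k.val = 0 then 0 else D ⟨k.val - 1, by omega⟩

theorem extendZero_zero {m : ℕ} (D : Fin (m - 1) → ℕ) (h : 0 < m) :
    extendZero D ⟨0, h⟩ = 0 := by
  simp [extendZero]

theorem extendZero_succ {m : ℕ} (D : Fin (m - 1) → ℕ) (i : Fin (m - 1)) (h : i.val + 1 < m) :
    extendZero D ⟨i.val + 1, h⟩ = D i := by
  simp [extendZero]

theorem genRow_eq (m b : ℕ) (f : (ZMod 2)[X]) (D : Fin (m - 1) → ℕ) (k : Fin m) :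
    genRow m b f D k =
      lastUnit (b * m) ᵥ* companionMatrix (b * m) f ^ (zIndex m b * extendZero D k) := by
  unfold genRow extendZero
  split <;> simp

theorem lastUnit_ne_zero {n : ℕ} (hn : 0 < n) : lastUnit n ≠ 0 := by
  intro h
  have := congrFun h ⟨n - 1, by omega⟩
  simp [lastUnit, show n - 1 + 1 = n by omega] at this

section

variable {ι : Type*} [Fintype ι] [DecidableEq ι] {f : (ZMod 2)[X]}

theorem not_dvd_X_pow_sub_X_pow {d e : ℕ}
    (hd : d < orderOf (AdjoinRoot.root f)) (he : e < orderOf (AdjoinRoot.root f)) (hde : d ≠ e) :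
    ¬ f ∣ X ^ d - X ^ e := by
  intro h
  rw [← AdjoinRoot.mk_eq_zero, map_sub, map_pow, map_pow, AdjoinRoot.mk_X, sub_eq_zero] at h
  exact hde (pow_injOn_Iio_orderOf hd he h)

theorem pow_orderOf_root {A : Matrix ι ι (ZMod 2)} (hA : aeval A f = 0) :
    A ^ orderOf (AdjoinRoot.root f) = 1 := by
  have h : f ∣ X ^ orderOf (AdjoinRoot.root f) - 1 := by
    rw [← AdjoinRoot.mk_eq_zero, map_sub, map_pow, AdjoinRoot.mk_X, pow_orderOf_eq_one, map_one,
      sub_self]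
  obtain ⟨q, hq⟩ := h
  have h1 := congrArg (aeval A) hq
  rw [map_mul, hA, zero_mul, map_sub, map_pow, aeval_X, map_one, sub_eq_zero] at h1
  exact h1

end

theorem genQ_row (m b : ℕ) (f : (ZMod 2)[X]) (D : Fin (m - 1) → ℕ) (r : Fin (b * m)) :
    genQ m b f D r = lastUnit (b * m) ᵥ* companionMatrix (b * m) f ^
      (zIndex m b * extendZero D (finProdFinEquiv.symm r).2 + (finProdFinEquiv.symm r).1) := by
  change genRow m b f D (finProdFinEquiv.symm r).2 ᵥ* _ = _
  rw [genRow_eq, Matrix.vecMul_vecMul, ← pow_add]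

theorem genQ_mulVec (m b : ℕ) (f : (ZMod 2)[X]) (D : Fin (m - 1) → ℕ)
    (y : Fin (b * m) → ZMod 2) (i : Fin b) (k : Fin m) :
    (genQ m b f D *ᵥ y) (finProdFinEquiv (i, k)) =
      (lastUnit (b * m) ᵥ* companionMatrix (b * m) f ^ (zIndex m b * extendZero D k + i)) ⬝ᵥ y := by
  rw [Matrix.mulVec, genQ_row, Equiv.symm_apply_apply]

/-! ### Output sequences and the configuration matrix -/

/-- The state of the output sequence `S` at time `t`. -/
def outputState {m : ℕ} (b : ℕ) (S : ℕ → Fin m → ZMod 2) (t : ℕ) : Fin b × Fin m → ZMod 2 :=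
  fun r => S (t + r.1) r.2

theorem configMatrix_mulVec_outputState {m b : ℕ} {B : Fin b → Matrix (Fin m) (Fin m) (ZMod 2)}
    {S : ℕ → Fin m → ZMod 2} (hS : IsOutput B S) (t : ℕ) :
    configMatrix B *ᵥ outputState b S t = outputState b S (t + 1) := by
  ext ⟨i, k⟩
  simp only [Matrix.mulVec, dotProduct, configMatrix, Matrix.of_apply, outputState]
  split_ifs with h
  · rw [show t + 1 + i.val = t + b by omega, hS t, Finset.sum_apply, Fintype.sum_prod_type]
    rfl
  · have hi : i.val + 1 < b := by omega
    rw [Finset.sum_eq_single (⟨i.val + 1, hi⟩, k)]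
    · simp [add_assoc, add_comm 1]
    · rintro ⟨j, l⟩ - hne
      rw [if_neg, zero_mul]
      rintro ⟨h1, h2⟩
      exact hne (Prod.ext (Fin.ext h1) h2)
    · simp

theorem configMatrix_pow_mulVec_outputState {m b : ℕ}
    {B : Fin b → Matrix (Fin m) (Fin m) (ZMod 2)} {S : ℕ → Fin m → ZMod 2} (hS : IsOutput B S)
    (t : ℕ) : configMatrix B ^ t *ᵥ outputState b S 0 = outputState b S t := by
  induction t with
  | zero => simp
  | succ t ih =>
    rw [pow_succ', ← Matrix.mulVec_mulVec, ih, configMatrix_mulVec_outputState hS]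

/-- Row (i, k) of Q M_f is row (i + 1, k) of Q, so multiplying by Q⁻¹ gives a row of the identity.
Only the last block row is free, and it supplies the gain matrices. -/
theorem configGen_eq_configMatrixFin {m b : ℕ} {f : (ZMod 2)[X]} {D : Fin (m - 1) → ℕ}
    (hQ : IsUnit (genQ m b f D)) :
    ∃ B : Fin b → Matrix (Fin m) (Fin m) (ZMod 2), configGen m b f D = configMatrixFin B := by
  -- The value 0 is a dummy: for b = 0 there is no last block, and no index j either.
  refine ⟨fun j => Matrix.of fun k l => if hb : 0 < b then configGen m b f D
    (finProdFinEquiv (⟨b - 1, by omega⟩, k)) (finProdFinEquiv (j, l)) else 0, ?_⟩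
  have hdet := (Matrix.isUnit_iff_isUnit_det _).mp hQ
  ext r s
  obtain ⟨⟨i, k⟩, rfl⟩ := finProdFinEquiv.surjective r
  obtain ⟨⟨j, l⟩, rfl⟩ := finProdFinEquiv.surjective s
  simp only [configMatrixFin, Matrix.reindex_apply, Matrix.submatrix_apply,
    Equiv.symm_apply_apply, configMatrix, Matrix.of_apply]
  split_ifs with h h2 h3
  · congr 3
    exact Fin.ext (by simp; omega)
  · omega
  all_goals
    have hi : i.val + 1 < b := by omega
    have hrow : (genQ m b f D * companionMatrix (b * m) f) (finProdFinEquiv (i, k)) =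
        genQ m b f D (finProdFinEquiv (⟨i.val + 1, hi⟩, k)) := by
      rw [Matrix.mul_apply_eq_vecMul, genQ_row, genQ_row, Equiv.symm_apply_apply,
        Equiv.symm_apply_apply, Matrix.vecMul_vecMul, ← pow_succ, add_assoc]
    have h4 : configGen m b f D (finProdFinEquiv (i, k)) =
        (1 : Matrix (Fin (b * m)) (Fin (b * m)) (ZMod 2)) (finProdFinEquiv (⟨i.val + 1, hi⟩, k)) := by
      rw [configGen, Matrix.mul_apply_eq_vecMul, hrow, ← Matrix.mul_apply_eq_vecMul,
        Matrix.mul_nonsing_inv _ hdet]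
    rw [h4, Matrix.one_apply]
  · obtain ⟨h5, h6⟩ := h3
    rw [if_pos]
    rw [h6, show j = ⟨i.val + 1, hi⟩ from Fin.ext h5]
  · rw [if_neg]
    intro h5
    have h6 := finProdFinEquiv.injective h5
    rw [Prod.mk.injEq] at h6
    exact h3 ⟨by rw [← h6.1], h6.2.symm⟩

/-- Every output sequence is given by powers of the companion matrix. -/
theorem exists_output_eq {m b : ℕ} (hb : 0 < b) {f : (ZMod 2)[X]} {D : Fin (m - 1) → ℕ}
    (hQ : IsUnit (genQ m b f D)) {B : Fin b → Matrix (Fin m) (Fin m) (ZMod 2)}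
    (hB : configGen m b f D = configMatrixFin B) {S : ℕ → Fin m → ZMod 2} (hS : IsOutput B S) :
    ∃ y : Fin (b * m) → ZMod 2, ∀ t k, S t k =
      (lastUnit (b * m) ᵥ* companionMatrix (b * m) f ^ (t + zIndex m b * extendZero D k)) ⬝ᵥ y := by
  have hdet := (Matrix.isUnit_iff_isUnit_det _).mp hQ
  set Q := genQ m b f D with hQdef
  set M := companionMatrix (b * m) f with hM
  set s := outputState b S 0 ∘ finProdFinEquiv.symm with hs
  refine ⟨Q⁻¹ *ᵥ s, fun t k => ?_⟩
  have hconj : configMatrixFin B ^ t * Q = Q * M ^ t := by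
    have h1 : configMatrixFin B * Q = Q * M := by
      rw [← hB, configGen, Matrix.nonsing_inv_mul_cancel_right _ _ hdet]
    exact ((show SemiconjBy Q M (configMatrixFin B) from h1.symm).pow_right t).symm
  have h2 : configMatrixFin B ^ t *ᵥ s = Q *ᵥ (M ^ t *ᵥ (Q⁻¹ *ᵥ s)) := by
    rw [Matrix.mulVec_mulVec, ← hconj, Matrix.mulVec_mulVec, Matrix.mul_assoc,
      Matrix.mul_nonsing_inv _ hdet, Matrix.mul_one]
  have h3 : configMatrixFin B ^ t *ᵥ s = outputState b S t ∘ finProdFinEquiv.symm := by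
    rw [← configMatrix_pow_mulVec_outputState hS]
    have : configMatrixFin B ^ t = Matrix.reindexAlgEquiv (ZMod 2) (ZMod 2) finProdFinEquiv
        (configMatrix B ^ t) := by
      rw [map_pow]; rfl
    rw [this, Matrix.coe_reindexAlgEquiv, Matrix.reindex_apply, hs, Matrix.submatrix_mulVec_equiv,
      Equiv.symm_symm, Function.comp_assoc, Equiv.symm_comp_self, Function.comp_id]
  -- Block 0 of the state at time t is S t itself.
  have h4 := congrFun (h2.symm.trans h3) (finProdFinEquiv (⟨0, hb⟩, k))
  rw [genQ_mulVec, ← Matrix.dotProduct_mulVec, Matrix.mulVec_mulVec] at h4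
  simp only [Function.comp_apply, Equiv.symm_apply_apply, outputState, add_zero] at h4
  rw [← h4, ← hM, ← pow_add, Matrix.dotProduct_mulVec, add_comm t]

/-- Independence makes Q invertible; the bound on D keeps z d_i below the order of the root, which
gives minimality of the distances. -/
theorem config_of_indepExponents {m b : ℕ} (hm : 0 < m) (hb : 0 < b)
    {f : (ZMod 2)[X]} (hf : IsPrimitivePoly f) (hfdeg : f.natDegree = m * b)
    {g : (ZMod 2)[X]} (hgdeg : g.natDegree = m)
    (hg : aeval (AdjoinRoot.root f ^ zIndex m b) g = 0) {D : Fin (m - 1) → ℕ}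
    (hD : ∀ i, D i < 2 ^ m - 1) (hind : IndepExponents g (extendZero D)) :
    IsUnit (genQ m b f D) ∧
      ∃ B : Fin b → Matrix (Fin m) (Fin m) (ZMod 2),
        configGen m b f D = configMatrixFin B ∧
        (configMatrix B).charpoly = f ∧
        IsDistanceVector B (fun i => zIndex m b * D i) ∧
        IsZPrimitive B := by
  obtain ⟨hfm, hfi, hford⟩ := hf
  have hf : IsPrimitivePoly f := ⟨hfm, hfi, hford⟩
  have : Fact (Irreducible f) := ⟨hfi⟩
  rw [hfdeg] at hford
  have hmin := minpoly_eq_of_orderOf hm (orderOf_pow_zIndex hm hb hford) hgdeg hg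
  have hfα : aeval (AdjoinRoot.root f) f = 0 := by simp
  have hchar := companionMatrix_charpoly (n := b * m) hfm (by rw [hfdeg, mul_comm])
  have hMf : aeval (companionMatrix (b * m) f) f = 0 := by
    conv => enter [1, 2]; rw [← hchar]
    exact Matrix.aeval_self_charpoly _
  have hQ : IsUnit (genQ m b f D) := by
    rw [← Matrix.linearIndependent_rows_iff_isUnit]
    have h := (hind.tower (b := b) hm hfm hfi hfdeg hfα hgdeg hmin).linearIndependent_vecMul
      hfi hMf (lastUnit_ne_zero (Nat.mul_pos hb hm))
    convert h.comp finProdFinEquiv.symm finProdFinEquiv.symm.injective using 1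
    funext r
    exact genQ_row m b f D r
  have hdet := (Matrix.isUnit_iff_isUnit_det _).mp hQ
  obtain ⟨B, hB⟩ := configGen_eq_configMatrixFin hQ
  have hBchar : (configMatrix B).charpoly = f := by
    have h1 : (configMatrixFin B).charpoly = (configMatrix B).charpoly :=
      Matrix.charpoly_reindex _ _
    rw [← h1, ← hB, configGen]
    conv_rhs => rw [← hchar]
    exact Matrix.charpoly_units_conj (Matrix.nonsingInvUnit _ hdet) _
  have hdist : IsDistanceVector B (fun i => zIndex m b * D i) := by
    intro S hS hS0 i
    obtain ⟨y, hy⟩ := exists_output_eq hb hQ hB hS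
    constructor
    · intro t
      rw [hy, hy, extendZero_zero, extendZero_succ, mul_zero, add_zero]
    · intro d hd
      by_contra hlt
      rw [not_le] at hlt
      have hzlt : zIndex m b * D i < orderOf (AdjoinRoot.root f) := by
        rw [hford, ← zIndex_mul b]
        exact Nat.mul_lt_mul_of_pos_left (hD i) (zIndex_pos hm hb)
      -- If a smaller d were also a shift, M_f^d - M_f^{z d_i} would be invertible and yet kill y,
      -- forcing S = 0.
      have hunit := isUnit_aeval_of_not_dvd hfi hMf
        (not_dvd_X_pow_sub_X_pow (f := f) (hlt.trans hzlt) hzlt hlt.ne)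
      have hzero : aeval (companionMatrix (b * m) f)
          (X ^ d - X ^ (zIndex m b * D i) : (ZMod 2)[X]) *ᵥ y = 0 := by
        apply Matrix.mulVec_injective_iff_isUnit.mpr hQ
        rw [Matrix.mulVec_zero]
        ext r
        obtain ⟨⟨j, k⟩, rfl⟩ := finProdFinEquiv.surjective r
        -- At these times the shift identity for d compares exactly the rows of Q.
        have h1 := hd (zIndex m b * extendZero D k + j)
        rw [hy, hy, extendZero_zero, extendZero_succ, mul_zero, add_zero] at h1
        rw [genQ_mulVec]
        simp only [map_sub, map_pow, aeval_X, Matrix.sub_mulVec, dotProduct_sub,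
          Matrix.dotProduct_mulVec, Matrix.vecMul_vecMul, ← pow_add, Pi.zero_apply]
        rw [h1, sub_self]
      have hy0 : y = 0 := Matrix.mulVec_injective_iff_isUnit.mpr hunit
        (hzero.trans (Matrix.mulVec_zero _).symm)
      apply hS0
      funext t k
      rw [hy, hy0]
      simp
  exact ⟨hQ, B, hB, hBchar, hdist, by rw [IsPrimitiveLFSR, hBchar]; exact hf, _, hdist,
    fun i => dvd_mul_right _ _⟩

/-! ### Distance vectors with one delay block -/

theorem isOutput_one_block {m : ℕ} (B : Fin 1 → Matrix (Fin m) (Fin m) (ZMod 2))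
    (s : Fin m → ZMod 2) : IsOutput B fun t => B 0 ^ t *ᵥ s := by
  intro t
  simp [pow_succ']

theorem charpoly_configMatrix_one_block {m : ℕ} (B : Fin 1 → Matrix (Fin m) (Fin m) (ZMod 2)) :
    (configMatrix B).charpoly = (B 0).charpoly := by
  rw [← Matrix.charpoly_reindex (Equiv.uniqueProd (Fin m) (Fin 1)) (configMatrix B)]
  congr 1

/-- A distance of at least the period 2^m - 1 could be reduced by it. The initial state s of an
output is arbitrary, so the distances say that the first unit vector times B_0^{d_k} is the k-th
unit vector; these are independent. -/
theorem bound_and_indepExponents_of_mem_zSet {m : ℕ} (hm : 0 < m) {g : (ZMod 2)[X]}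
    (hg : IsPrimitivePoly g) (hgdeg : g.natDegree = m) {D : Fin (m - 1) → ℕ}
    (hD : D ∈ zSet m 1 g) : (∀ i, D i < 2 ^ m - 1) ∧ IndepExponents g (extendZero D) := by
  obtain ⟨B, hBchar, -, hdist⟩ := hD
  rw [charpoly_configMatrix_one_block] at hBchar
  have hA : aeval (B 0) g = 0 := by
    rw [← hBchar]; exact Matrix.aeval_self_charpoly _
  have hper := pow_orderOf_root hA
  rw [hg.2.2, hgdeg] at hper
  have hpos := two_pow_sub_one_pos hm
  have hne : ∀ s : Fin m → ZMod 2, s ≠ 0 → (fun t => B 0 ^ t *ᵥ s) ≠ 0 := by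
    intro s hs h
    exact hs (by simpa using congrFun h 0)
  refine ⟨fun i => ?_, ?_⟩
  · have hl := hdist _ (isOutput_one_block B _) (hne _ (lastUnit_ne_zero hm)) i
    by_contra hge
    rw [not_lt] at hge
    have h : D i ≤ D i - (2 ^ m - 1) := hl.2 (fun t => by
      have h1 := hl.1 t
      obtain ⟨c, hc⟩ := Nat.exists_eq_add_of_le hge
      rw [hc, Nat.add_sub_cancel_left]
      rw [hc, show t + (2 ^ m - 1 + c) = (2 ^ m - 1) + (t + c) by ring, pow_add (B 0) (2 ^ m - 1),
        hper, one_mul] at h1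
      exact h1)
    omega
  · refine indepExponents_of_linearIndependent_vecMul hA (v := Pi.single ⟨0, hm⟩ 1) ?_
    convert (Pi.basisFun (ZMod 2) (Fin m)).linearIndependent using 1
    funext k
    apply dotProduct_eq
    intro s
    rw [← Matrix.dotProduct_mulVec, single_one_dotProduct, Pi.basisFun_apply, single_one_dotProduct]
    -- Distances are defined by nonzero outputs only.
    by_cases hs : s = 0
    · simp [hs]
    rcases Nat.eq_zero_or_pos k.val with hk | hk
    · rw [show k = ⟨0, hm⟩ from Fin.ext hk, extendZero_zero, pow_zero, Matrix.one_mulVec]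
    · have hl := (hdist _ (isOutput_one_block B s) (hne s hs) ⟨k.val - 1, by omega⟩).1 0
      rw [show k = ⟨(⟨k.val - 1, by omega⟩ : Fin (m - 1)).val + 1, by simp; omega⟩ from
        Fin.ext (by simp; omega), extendZero_succ]
      simpa using hl.symm

/-! ### Correctness of the sampling algorithm -/

section Sampling

variable {m : ℕ}

/-- The first `i` rows of `A` form an echelon matrix with respect to the antidiagonal. -/
def IsEchelon (A : Matrix (Fin m) (Fin m) (ZMod 2)) (i : ℕ) : Prop :=
  ∀ j : Fin m, j.val < i → A j (Fin.rev j) = 1 ∧ ∀ k < j, A j (Fin.rev k) = 0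

/-- Adding the multiple of row j clears its antidiagonal column, as 1 + 1 = 0; row j vanishes in the
columns cleared earlier, so they stay clear. -/
theorem reduceRow_apply_rev {A : Matrix (Fin m) (Fin m) (ZMod 2)} {i : ℕ} (hA : IsEchelon A i)
    (v : Fin m → ZMod 2) : ∀ j ≤ i, ∀ k : Fin m, k.val < j → reduceRow A v j (Fin.rev k) = 0 := by
  intro j
  induction j with
  | zero => intro _ k hk; omega
  | succ j ih =>
    intro hj k hk
    rw [reduceRow]
    split_ifs with h
    · obtain ⟨h1, h2⟩ := hA ⟨j, h⟩ hj
      rw [Pi.add_apply, Pi.smul_apply, smul_eq_mul]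
      rcases Nat.lt_succ_iff_lt_or_eq.mp hk with hk | hk
      · rw [ih (by omega) k hk, h2 k hk, mul_zero, add_zero]
      · rw [show k = ⟨j, h⟩ from Fin.ext hk, h1, mul_one, CharTwo.add_self_eq_zero]
    · exact ih (by omega) k (by omega)

theorem reduceRow_mem {A : Matrix (Fin m) (Fin m) (ZMod 2)} {v : Fin m → ZMod 2}
    {W : Submodule (ZMod 2) (Fin m → ZMod 2)} (hv : v ∈ W) (j : ℕ)
    (hA : ∀ k : Fin m, k.val < j → A k ∈ W) : reduceRow A v j ∈ W := by
  induction j with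
  | zero => exact hv
  | succ j ih =>
    have ih := ih fun k hk => hA k (by omega)
    rw [reduceRow]
    split_ifs with h
    · exact W.add_mem ih (W.smul_mem _ (hA _ (Nat.lt_succ_self j)))
    · exact ih

theorem IsEchelon.linearIndependent_rows {A : Matrix (Fin m) (Fin m) (ZMod 2)}
    (hA : IsEchelon A m) : LinearIndependent (ZMod 2) A.row := by
  apply Matrix.linearIndependent_rows_of_det_ne_zero
  -- Reversing the columns makes the matrix upper triangular with ones on the diagonal.
  have h := Matrix.det_permute' Fin.revPerm A
  have htri : (A.submatrix id Fin.revPerm).BlockTriangular id := fun j k hjk =>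
    (hA j j.isLt).2 k hjk
  rw [Matrix.det_of_isUpperTriangular htri] at h
  intro h0
  rw [show A.det = 0 from h0, mul_zero] at h
  refine Finset.prod_ne_zero_iff.mpr (fun j _ => ?_) h
  have h1 : A j (Fin.rev j) = 1 := (hA j j.isLt).1
  simp [h1]

/-- The span of the row vectors `e` and `e * A ^ d` for `d` in the list `l`. -/
def powerSpan (A : Matrix (Fin m) (Fin m) (ZMod 2)) (l : List ℕ) :
    Submodule (ZMod 2) (Fin m → ZMod 2) :=
  Submodule.span (ZMod 2) {w | ∃ d ∈ 0 :: l, lastUnit m ᵥ* A ^ d = w}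

theorem powerSpan_mono {A : Matrix (Fin m) (Fin m) (ZMod 2)} {l₁ l₂ : List ℕ} (h : l₁ ⊆ l₂) :
    powerSpan A l₁ ≤ powerSpan A l₂ :=
  Submodule.span_mono fun _ ⟨d, hd, hw⟩ => ⟨d, List.cons_subset_cons 0 h hd, hw⟩

/-- The invariant of the sampling algorithm. -/
structure GenInvariant (A : Matrix (Fin m) (Fin m) (ZMod 2)) (s : GenState m) : Prop where
  echelon : IsEchelon s.M₂ s.i
  mem_powerSpan : ∀ j : Fin m, j.val < s.i → s.M₂ j ∈ powerSpan A s.list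
  le_of_mem : ∀ d ∈ s.list, d ≤ 2 ^ m - 1

theorem genInvariant_init (A : Matrix (Fin m) (Fin m) (ZMod 2)) :
    GenInvariant A (genInit m) where
  echelon := by
    intro j hj
    have hj : j.val = 0 := Nat.lt_one_iff.mp hj
    refine ⟨?_, fun k hk => absurd (Fin.lt_def.mp hk) (by omega)⟩
    simp [genInit, hj, lastUnit]
    omega
  mem_powerSpan := by
    intro j hj
    have hj : j.val = 0 := Nat.lt_one_iff.mp hj
    refine Submodule.subset_span ⟨0, by simp, ?_⟩
    rw [pow_zero, Matrix.vecMul_one]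
    exact (if_pos hj).symm
  le_of_mem := by simp [genInit]

theorem GenInvariant.step {A : Matrix (Fin m) (Fin m) (ZMod 2)} {s : GenState m}
    (hs : GenInvariant A s) (h : s.i < m) {d : ℕ} (hd : d ≤ 2 ^ m - 1) :
    GenInvariant A (genStep A s h d) := by
  set v := lastUnit m ᵥ* A ^ d with hv
  set u := reduceRow s.M₂ v s.i with hu
  have hrow : ∀ j : Fin m, j.val < s.i → (s.M₂.updateRow ⟨s.i, h⟩ u) j = s.M₂ j := by
    intro j hj
    exact Matrix.updateRow_ne (by rintro rfl; exact lt_irrefl _ hj)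
  have hself : (s.M₂.updateRow ⟨s.i, h⟩ u) ⟨s.i, h⟩ = u := Matrix.updateRow_self
  by_cases hacc : u (Fin.rev ⟨s.i, h⟩) = 1
  · have hstep : genStep A s h d = ⟨s.i + 1, s.M₁.updateRow ⟨s.i, h⟩ v,
        s.M₂.updateRow ⟨s.i, h⟩ u, s.list ++ [d]⟩ := by
      simp only [genStep, ← hv, ← hu, if_pos hacc]
    rw [hstep]
    have hcase : ∀ j : Fin m, j.val < s.i + 1 → j.val < s.i ∨ j = ⟨s.i, h⟩ := fun j hj =>
      (Nat.lt_succ_iff_lt_or_eq.mp hj).imp_right Fin.ext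
    have hmono : powerSpan A s.list ≤ powerSpan A (s.list ++ [d]) :=
      powerSpan_mono (List.subset_append_left _ _)
    refine ⟨fun j hj => ?_, fun j hj => ?_, fun d' hd' => ?_⟩
    · rcases hcase j hj with hj | rfl
      · simp only [hrow j hj]
        exact hs.echelon j hj
      · simp only [hself]
        exact ⟨hacc, fun k hk => reduceRow_apply_rev hs.echelon v _ le_rfl k hk⟩
    · rcases hcase j hj with hj | rfl
      · simp only [hrow j hj]
        exact hmono (hs.mem_powerSpan j hj)
      · simp only [hself]
        exact reduceRow_mem (W := powerSpan A (s.list ++ [d]))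
          (Submodule.subset_span ⟨d, by simp, rfl⟩) _
          fun k hk => hmono (hs.mem_powerSpan k hk)
    · rcases List.mem_append.mp hd' with hd' | hd'
      · exact hs.le_of_mem d' hd'
      · rwa [List.mem_singleton.mp hd']
  · have hstep : genStep A s h d = ⟨s.i, s.M₁.updateRow ⟨s.i, h⟩ v,
        s.M₂.updateRow ⟨s.i, h⟩ u, s.list⟩ := by
      simp only [genStep, ← hv, ← hu, if_neg hacc]
    rw [hstep]
    -- A rejected draw overwrites only row `s.i`, on which the invariant says nothing.
    refine ⟨fun j hj => ?_, fun j hj => ?_, hs.le_of_mem⟩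
    · simp only [hrow j hj]
      exact hs.echelon j hj
    · simp only [hrow j hj]
      exact hs.mem_powerSpan j hj

theorem GenReachable.invariant {A : Matrix (Fin m) (Fin m) (ZMod 2)} {s : GenState m}
    (hs : GenReachable A s) : GenInvariant A s := by
  induction hs with
  | init => exact genInvariant_init A
  | step s d _ h hd ih => exact ih.step h hd.2

/-- The echelon rows span the whole space and lie in the span of the m vectors e M_g^{d_k}; m
spanning vectors are independent. A draw d = 2^m - 1 would repeat e, so it is never accepted. -/
theorem bound_and_indepExponents_of_isGenOutput (hm : 0 < m) {g : (ZMod 2)[X]}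
    (hg : IsPrimitivePoly g) (hgdeg : g.natDegree = m) {D : Fin (m - 1) → ℕ}
    (hD : IsGenOutput m g D) : (∀ i, D i < 2 ^ m - 1) ∧ IndepExponents g (extendZero D) := by
  obtain ⟨s, hs, hi, hl⟩ := hD
  have hinv := hs.invariant
  have hA : aeval (companionMatrix m g) g = 0 := by
    conv => enter [1, 2]; rw [← companionMatrix_charpoly hg.1 hgdeg]
    exact Matrix.aeval_self_charpoly _
  have hper := pow_orderOf_root hA
  rw [hg.2.2, hgdeg] at hper
  set A := companionMatrix m g
  have hrows : Submodule.span (ZMod 2) (Set.range s.M₂.row) = ⊤ := by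
    have : Nonempty (Fin m) := ⟨⟨0, hm⟩⟩
    have hech := hinv.echelon
    rw [hi] at hech
    exact hech.linearIndependent_rows.span_eq_top_of_card_eq_finrank (by simp)
  have htop : ⊤ ≤ powerSpan A s.list := by
    rw [← hrows, Submodule.span_le]
    rintro _ ⟨j, rfl⟩
    exact hinv.mem_powerSpan j (hi.symm ▸ j.isLt)
  have hli : LinearIndependent (ZMod 2) fun k => lastUnit m ᵥ* A ^ extendZero D k := by
    refine linearIndependent_of_top_le_span_of_card_eq_finrank (htop.trans ?_) (by simp)
    refine Submodule.span_mono ?_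
    rintro _ ⟨d, hd, rfl⟩
    rw [hl, List.mem_cons, List.mem_ofFn] at hd
    rcases hd with rfl | ⟨i, rfl⟩
    · exact ⟨⟨0, hm⟩, by simp only [extendZero_zero]⟩
    · exact ⟨⟨i.val + 1, by omega⟩, by simp only [extendZero_succ]⟩
  refine ⟨fun i => lt_of_le_of_ne (hinv.le_of_mem _ ?_) fun h => ?_,
    indepExponents_of_linearIndependent_vecMul hA hli⟩
  · rw [hl, List.mem_ofFn]
    exact ⟨i, rfl⟩
  · have h1 := hli.injective (a₁ := ⟨i.val + 1, by omega⟩) (a₂ := ⟨0, hm⟩) (by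
      simp only [extendZero_zero, extendZero_succ, h, hper, pow_zero])
    simp at h1

end Sampling

end SigmaLFSR

theorem mainTheorem1 (m b : ℕ) (hm : 0 < m) (hb : 0 < b)
    (f : (ZMod 2)[X]) (hf : IsPrimitivePoly f) (hfdeg : f.natDegree = m * b)
    {K : Type*} [Field K] [Algebra (ZMod 2) K] (α : K) (hα : aeval α f = 0)
    (g : (ZMod 2)[X]) (hgdeg : g.natDegree = m) (hg : aeval (α ^ zIndex m b) g = 0) :
    (∀ D : Fin (m - 1) → ℕ, IsGenOutput m g D → D ∈ zSet m 1 g) ∧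
    ∀ D : Fin (m - 1) → ℕ, D ∈ zSet m 1 g →
      IsUnit (genQ m b f D) ∧
      ∃ B : Fin b → Matrix (Fin m) (Fin m) (ZMod 2),
        configGen m b f D = configMatrixFin B ∧
        (configMatrix B).charpoly = f ∧
        IsDistanceVector B (fun i => zIndex m b * D i) ∧
        IsZPrimitive B := by
  have : Fact (Irreducible f) := ⟨hf.2.1⟩
  have hord : orderOf α = 2 ^ (m * b) - 1 := by
    rw [← orderOf_root_eq hf.2.1 hα, hf.2.2, hfdeg]
  have hgprim : IsPrimitivePoly g :=
    isPrimitivePoly_of_orderOf hm (orderOf_pow_zIndex hm hb hord) hgdeg hg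
  -- The given root α is exchanged for the canonical one through the embedding of 𝔽₂[x]/(f) into K.
  have hgroot : aeval (AdjoinRoot.root f ^ zIndex m b) g = 0 := by
    set φ := AdjoinRoot.liftAlgHom f (Algebra.ofId (ZMod 2) K) α hα
    have hφ : φ (AdjoinRoot.root f) = α := AdjoinRoot.lift_root hα
    apply (φ : AdjoinRoot f →+* K).injective
    rw [map_zero, ← hg, ← hφ, ← map_pow]
    exact (aeval_algHom_apply φ _ g).symm
  constructor
  · intro D hD
    obtain ⟨hlt, hind⟩ := bound_and_indepExponents_of_isGenOutput hm hgprim hgdeg hD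
    -- One delay block with f = g, where z = 1.
    obtain ⟨-, B, -, hchar, hdist, hz⟩ := config_of_indepExponents hm one_pos hgprim
      (by rw [hgdeg, mul_one]) hgdeg (by rw [zIndex_one hm, pow_one]; simp) hlt hind
    simp only [zIndex_one hm, one_mul] at hdist
    exact ⟨B, hchar, hz, hdist⟩
  · intro D hD
    obtain ⟨hlt, hind⟩ := bound_and_indepExponents_of_mem_zSet hm hgprim hgdeg hD
    exact config_of_indepExponents hm hb hf hfdeg hgdeg hgroot hlt hind
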